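/- \textbf{Corollary (Multiple solutions in autoconvolution).} Let $X=L^2(0,1)$ and $Y=L^2(0,2)$ be the spaces of complex-valued square-integrable functions, and let $F:X\to Y$ be the autoconvolution operator $$(F(x))(s)=\int_{\max\{s-1,0\}}^{\min\{s,1\}}x(s-t)\,x(t)\,\mathrm{d}t,\qquad s\in(0,2).$$ Let $y^\dagger\in Y$ and let $x^\dagger\in X$ be any solution of $F(x)=y^\dagger$ (no sparsity or other assumption on $x^\dagger$ is made). Put $\Omega(x)=\|x\|^2$ (the squared $L^2$-norm) and $$E^\dagger(x)=\min\{\|x-x^\dagger\|^2,\ \|x+x^\dagger\|^2\},\qquad x\in X.$$ Then the minimum $\Omega^\dagger:=\min\{\Omega(x):x\in X,\ F(x)=y^\dagger\}$ exists, and there are a constant $\beta\in(0,1)$ and a concave index function $\varphi$ such that the variational source condition $$\beta\,E^\dagger(x)\le\Omega(x)-\Omega^\dagger+\varphi\bigl(\|F(x)-y^\dagger\|\bigr)$$ holds for all $x\in X$. Here an index function is a function $\varphi:[0,\infty)\to[0,\infty)$ that is continuous, monotonically increasing, strictly increasing in a neighborhood of zero, and satisfies $\varphi(0)=0$. -/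

import Mathlib

open MeasureTheory Set
open scoped NNReal ENNReal

/-- The complex Hilbert space `L²(0,1)`. -/
abbrev L2Unit : Type := Lp ℂ 2 (volume.restrict (Ioo (0 : ℝ) 1))

/-- The complex Hilbert space `L²(0,2)`. -/
abbrev L2Two : Type := Lp ℂ 2 (volume.restrict (Ioo (0 : ℝ) 2))

/-- The autoconvolution `s ↦ ∫_{max(s-1,0)}^{min(s,1)} x(s-t) x(t) dt` as a function of `s`. For
`s` in `(0,2)` the value does not depend on the representative of `x`. -/
noncomputable def autoconvFun (x : L2Unit) (s : ℝ) : ℂ :=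
  ∫ t in (max (s - 1) 0)..(min s 1), x (s - t) * x t

/-- On `(0,2)` the autoconvolution is the convolution over `ℝ` of the extension by zero. -/
theorem autoconvFun_eq_convolution (x : L2Unit) {s : ℝ} (hs : s ∈ Ioo (0 : ℝ) 2) :
    autoconvFun x s =
      ∫ t, (Ioo (0 : ℝ) 1).indicator x t * (Ioo (0 : ℝ) 1).indicator x (s - t) := by
  have hle : max (s - 1) 0 ≤ min s 1 := by
    rcases hs with ⟨h0, h2⟩
    refine max_le (le_min ?_ ?_) (le_min ?_ ?_) <;> linarith
  rw [autoconvFun, intervalIntegral.integral_of_le hle, integral_Ioc_eq_integral_Ioo,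
    ← integral_indicator measurableSet_Ioo]
  congr 1
  funext t
  by_cases h1 : t ∈ Ioo (0 : ℝ) 1
  · by_cases h2 : s - t ∈ Ioo (0 : ℝ) 1
    · have : t ∈ Ioo (max (s - 1) 0) (min s 1) := by
        simp only [mem_Ioo, max_lt_iff, lt_min_iff] at *
        refine ⟨⟨?_, ?_⟩, ?_, ?_⟩ <;> linarith
      rw [indicator_of_mem this, indicator_of_mem h1, indicator_of_mem h2, mul_comm]
    · have : t ∉ Ioo (max (s - 1) 0) (min s 1) := by
        intro h
        apply h2
        simp only [mem_Ioo, max_lt_iff, lt_min_iff] at *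
        constructor <;> linarith
      rw [indicator_of_notMem this, indicator_of_notMem h2, mul_zero]
  · have : t ∉ Ioo (max (s - 1) 0) (min s 1) := by
      intro h
      apply h1
      simp only [mem_Ioo, max_lt_iff, lt_min_iff] at *
      constructor <;> linarith
    rw [indicator_of_notMem this, indicator_of_notMem h1, zero_mul]

/-- The autoconvolution of an `L²(0,1)` function is in `L²(0,2)`. -/
theorem memLp_autoconvFun (x : L2Unit) :
    MemLp (autoconvFun x) 2 (volume.restrict (Ioo (0 : ℝ) 2)) := by
  set g : ℝ → ℂ := (Ioo (0 : ℝ) 1).indicator x with hg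
  have hg2 : MemLp g 2 volume := (memLp_indicator_iff_restrict measurableSet_Ioo).2 (Lp.memLp x)
  have hg1 : Integrable g volume := by
    rw [hg, integrable_indicator_iff measurableSet_Ioo]
    exact (Lp.memLp x).integrable (by norm_num)
  have hsq : Integrable (fun t => ‖g t‖ ^ 2) volume := hg2.integrable_norm_pow (by norm_num)
  have hEq : ∀ s ∈ Ioo (0 : ℝ) 2, autoconvFun x s = ∫ t, g t * g (s - t) :=
    fun s hs => autoconvFun_eq_convolution x hs
  have hmeas : AEStronglyMeasurable (fun s => ∫ t, g t * g (s - t)) volume :=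
    (hg1.integrable_convolution (ContinuousLinearMap.mul ℝ ℂ) hg1).aestronglyMeasurable
  refine MemLp.of_bound ?_ (∫ t, ‖g t‖ ^ 2) ?_
  · refine hmeas.restrict.congr ?_
    filter_upwards [ae_restrict_mem measurableSet_Ioo] with s hs
    exact (hEq s hs).symm
  · filter_upwards [ae_restrict_mem measurableSet_Ioo] with s hs
    have hshift : Integrable (fun t => ‖g (s - t)‖ ^ 2) volume := hsq.comp_sub_left s
    have hbd : Integrable (fun t => (‖g t‖ ^ 2 + ‖g (s - t)‖ ^ 2) / 2) volume :=
      (hsq.add hshift).div_const 2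
    rw [hEq s hs]
    refine (norm_integral_le_of_norm_le hbd (Filter.Eventually.of_forall fun t => ?_)).trans
      (le_of_eq ?_)
    · rw [norm_mul]
      nlinarith [sq_nonneg (‖g t‖ - ‖g (s - t)‖)]
    · rw [integral_div, integral_add hsq hshift,
        integral_sub_left_eq_self (fun t => ‖g t‖ ^ 2) volume s]
      ring

/-- The complex autoconvolution operator `F : L²(0,1) → L²(0,2)`. -/
noncomputable def autoconv (x : L2Unit) : L2Two := (memLp_autoconvFun x).toLp (autoconvFun x)

/-- Index functions `φ : [0,∞) → [0,∞)`: continuous, monotonically increasing, strictly increasing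
in a neighbourhood of zero, with `φ(0) = 0`. -/
structure IsIndexFunction (φ : ℝ≥0 → ℝ≥0) : Prop where
  continuous : Continuous φ
  monotone : Monotone φ
  strictMono_near_zero : ∃ ε : ℝ≥0, 0 < ε ∧ StrictMonoOn φ (Icc 0 ε)
  map_zero : φ 0 = 0

/-- The variational source condition on the set `M` for the equation `F x = y`, where `F` is
defined on all of `X`: the minimum `Ωdag` of `Ω` over all solutions exists, and
`β E(x) ≤ Ω(x) - Ωdag + φ(‖F(x) - y‖)` for all `x` in `M`. -/
def VariationalSourceCondition {X Y : Type*} [NormedAddCommGroup Y] (F : X → Y) (y : Y)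
    (Ω E : X → ℝ) (β : ℝ) (φ : ℝ≥0 → ℝ≥0) (M : Set X) : Prop :=
  ∃ Ωdag : ℝ, IsLeast (Ω '' {x | F x = y}) Ωdag ∧
    ∀ x ∈ M, β * E x ≤ Ω x - Ωdag + (φ ‖F x - y‖₊ : ℝ)

/-- The squared distance from `x` to the set `{xdag, -xdag}`. -/
noncomputable def twoPointError (xdag x : L2Unit) : ℝ :=
  min (‖x - xdag‖ ^ 2) (‖x + xdag‖ ^ 2)

/-! The Laplace transform turns autoconvolution into squaring. Since entire functions form an
integral domain, `autoconv x = autoconv y` forces `x = ±y` (`autoconv_eq_autoconv_iff`), so all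
solutions have norm `‖xdag‖`. The moments are also weakly continuous: if `autoconv (u i)` tends to
`autoconv y` with `u i` bounded, weak limits are `±y`. The defect `¼ E(x) - ‖x‖² + ‖y‖²` lies below
a weakly continuous functional vanishing at such a limit, so its positive part tends to 0 with the
residual. For every `ε` it is thus at most `ε + K_ε * residual`; the infimum of these affine bounds
gives `φ`. -/

open Filter Topology

/-! ### Laplace transform and injectivity up to sign. -/

section ExpMoment

/-- The Laplace transform `z ↦ ∫₀ᵀ e^{zt} x(t) dt` of a function in `L²(0,T)`. -/
noncomputable def expMoment {T : ℝ} (x : Lp ℂ 2 (volume.restrict (Ioo (0 : ℝ) T))) (z : ℂ) : ℂ :=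
  ∫ t in Ioo (0 : ℝ) T, Complex.exp (z * t) * x t

theorem norm_exp_mul_ofReal_le {T t : ℝ} (ht : t ∈ Ioo (0 : ℝ) T) (z : ℂ) :
    ‖Complex.exp (z * t)‖ ≤ Real.exp (‖z‖ * T) := by
  rw [Complex.norm_exp]
  refine Real.exp_le_exp.2 ((Complex.re_le_norm _).trans ?_)
  rw [norm_mul, Complex.norm_real, Real.norm_of_nonneg ht.1.le]
  exact mul_le_mul_of_nonneg_left ht.2.le (norm_nonneg z)

theorem memLp_exp_mul (T : ℝ) (z : ℂ) :
    MemLp (fun t : ℝ => Complex.exp (z * t)) 2 (volume.restrict (Ioo (0 : ℝ) T)) := by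
  refine MemLp.of_bound (by fun_prop) (Real.exp (‖z‖ * T)) ?_
  filter_upwards [ae_restrict_mem measurableSet_Ioo] with t ht
  exact norm_exp_mul_ofReal_le ht z

/-- Pairing with a fixed vector makes each moment weakly continuous. -/
theorem expMoment_eq_inner {T : ℝ} (x : Lp ℂ 2 (volume.restrict (Ioo (0 : ℝ) T))) (z : ℂ) :
    expMoment x z = inner ℂ ((memLp_exp_mul T (starRingEnd ℂ z)).toLp _) x := by
  rw [L2.inner_def, expMoment]
  refine integral_congr_ae ?_
  filter_upwards [(memLp_exp_mul T (starRingEnd ℂ z)).coeFn_toLp] with t ht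
  rw [ht, RCLike.inner_apply, ← Complex.exp_conj, map_mul, Complex.conj_conj, Complex.conj_ofReal,
    mul_comm]

theorem expMoment_add {T : ℝ} (x y : Lp ℂ 2 (volume.restrict (Ioo (0 : ℝ) T))) (z : ℂ) :
    expMoment (x + y) z = expMoment x z + expMoment y z := by
  simp only [expMoment_eq_inner, inner_add_right]

theorem expMoment_sub {T : ℝ} (x y : Lp ℂ 2 (volume.restrict (Ioo (0 : ℝ) T))) (z : ℂ) :
    expMoment (x - y) z = expMoment x z - expMoment y z := by
  simp only [expMoment_eq_inner, inner_sub_right]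

theorem differentiable_expMoment {T : ℝ} (x : Lp ℂ 2 (volume.restrict (Ioo (0 : ℝ) T))) :
    Differentiable ℂ (expMoment x) := by
  intro z₀
  have hx : Integrable x (volume.restrict (Ioo (0 : ℝ) T)) := (Lp.memLp x).integrable (by norm_num)
  have hm := hx.aestronglyMeasurable
  refine (hasDerivAt_integral_of_dominated_loc_of_deriv_le
    (F := fun z t => Complex.exp (z * t) * x t)
    (F' := fun z t => Complex.exp (z * t) * t * x t)
    (bound := fun t => Real.exp ((‖z₀‖ + 1) * T) * T * ‖x t‖)
    (Metric.ball_mem_nhds z₀ one_pos) ?_ ?_ ?_ ?_ (hx.norm.const_mul _) ?_).2.differentiableAt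
  · refine Eventually.of_forall fun z => AEStronglyMeasurable.mul ?_ hm
    exact Continuous.aestronglyMeasurable (by fun_prop)
  · exact (memLp_exp_mul T z₀).integrable_mul (Lp.memLp x)
  · refine AEStronglyMeasurable.mul ?_ hm
    exact Continuous.aestronglyMeasurable (by fun_prop)
  · filter_upwards [ae_restrict_mem measurableSet_Ioo] with t ht z hz
    have hT : 0 ≤ T := (ht.1.trans ht.2).le
    have hz' : ‖z‖ ≤ ‖z₀‖ + 1 := by
      have := norm_sub_norm_le z z₀
      rw [Metric.mem_ball, dist_eq_norm] at hz
      linarith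
    rw [norm_mul, norm_mul, Complex.norm_real, Real.norm_of_nonneg ht.1.le]
    refine mul_le_mul_of_nonneg_right ?_ (norm_nonneg _)
    refine mul_le_mul ((norm_exp_mul_ofReal_le ht z).trans ?_) ht.2.le ht.1.le (Real.exp_pos _).le
    exact Real.exp_le_exp.2 (mul_le_mul_of_nonneg_right hz' hT)
  · refine Eventually.of_forall fun t z _ => ?_
    exact (((hasDerivAt_mul_const (t : ℂ)).cexp).mul_const (x t))

/-- A test function `g` is the Fourier transform of a Schwartz function `H`; in `∫ g f` the
transform moves from `H` onto `f`, where it vanishes. -/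
theorem ae_eq_zero_of_fourier_eq_zero {f : ℝ → ℂ} (hf : Integrable f)
    (h : ∀ ξ : ℝ, ∫ t : ℝ, Complex.exp (-(2 * Real.pi * t * ξ) * Complex.I) * f t = 0) :
    ∀ᵐ t, f t = 0 := by
  refine ae_eq_zero_of_integral_contDiff_smul_eq_zero hf.locallyIntegrable fun g hg hgs => ?_
  have h₁ : HasCompactSupport (Complex.ofRealCLM ∘ g) := hgs.comp_left rfl
  have h₂ : ContDiff ℝ (↑(⊤ : ℕ∞)) (Complex.ofRealCLM ∘ g) := by fun_prop
  set G := h₁.toSchwartzMap h₂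
  set H : SchwartzMap ℝ ℂ := FourierTransformInv.fourierInv G
  have hH : FourierTransform.fourier H = G := FourierTransform.fourier_fourierInv_eq G
  have key := VectorFourier.integral_fourierIntegral_smul_eq_flip (L := innerₗ ℝ)
    (μ := volume) (ν := volume) (f := f) (g := (H : ℝ → ℂ)) Real.continuous_fourierChar
    continuous_inner hf H.integrable
  have h0 : ∀ ξ : ℝ, VectorFourier.fourierIntegral Real.fourierChar volume (innerₗ ℝ) f ξ = 0 := by
    intro ξ
    rw [← h ξ]
    refine integral_congr_ae (Eventually.of_forall fun t => ?_)
    simp only [Circle.smul_def, Real.fourierChar_apply, smul_eq_mul, innerₗ_apply_apply]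
    congr 2
    simp
    ring
  simp only [h0, zero_smul, integral_zero] at key
  rw [key]
  refine integral_congr_ae (Eventually.of_forall fun t => ?_)
  have : VectorFourier.fourierIntegral Real.fourierChar volume (innerₗ ℝ).flip (H : ℝ → ℂ) t
      = (g t : ℂ) := by
    rw [flip_innerₗ]
    change FourierTransform.fourier (H : ℝ → ℂ) t = _
    rw [← SchwartzMap.fourier_coe, hH]
    rfl
  simp only [this, Complex.real_smul, smul_eq_mul, mul_comm]

theorem eq_zero_of_expMoment_eq_zero {T : ℝ} {x : Lp ℂ 2 (volume.restrict (Ioo (0 : ℝ) T))}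
    (h : ∀ z, expMoment x z = 0) : x = 0 := by
  have hx : Integrable x (volume.restrict (Ioo (0 : ℝ) T)) := (Lp.memLp x).integrable (by norm_num)
  have hae := ae_eq_zero_of_fourier_eq_zero
    ((integrable_indicator_iff measurableSet_Ioo).2 hx) fun ξ => by
      -- On the imaginary axis the moment is the Fourier transform of the extension by zero.
      rw [← h (-(2 * Real.pi * ξ) * Complex.I), expMoment, ← integral_indicator measurableSet_Ioo]
      congr 1
      funext t
      by_cases ht : t ∈ Ioo (0 : ℝ) T
      · rw [indicator_of_mem ht, indicator_of_mem ht]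
        ring_nf
      · rw [indicator_of_notMem ht, indicator_of_notMem ht, mul_zero]
  rw [Lp.eq_zero_iff_ae_eq_zero]
  filter_upwards [ae_restrict_of_ae hae, ae_restrict_mem measurableSet_Ioo] with t ht htm
  rwa [indicator_of_mem htm] at ht

/-- The weight is multiplicative, `e^{zs} = e^{zt} e^{z(s-t)}`, so it passes into the convolution,
whose integral is a product. -/
theorem expMoment_autoconv (x : L2Unit) (z : ℂ) :
    expMoment (autoconv x) z = expMoment x z ^ 2 := by
  set g : ℝ → ℂ := fun t => Complex.exp (z * t) * (Ioo (0 : ℝ) 1).indicator x t with hg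
  have hgi : g = (Ioo (0 : ℝ) 1).indicator fun t => Complex.exp (z * t) * x t := by
    funext t
    exact (indicator_mul_right (Ioo (0 : ℝ) 1) (fun t : ℝ => Complex.exp (z * t)) x).symm
  have hgint : Integrable g := by
    rw [hgi, integrable_indicator_iff measurableSet_Ioo]
    exact (memLp_exp_mul 1 z).integrable_mul (Lp.memLp x)
  have hconv := integral_convolution (ContinuousLinearMap.mul ℝ ℂ) hgint hgint
  have hgx : ∫ t, g t = expMoment x z := by
    rw [hgi, integral_indicator measurableSet_Ioo, expMoment]
  rw [hgx, ContinuousLinearMap.mul_apply', ← sq] at hconv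
  rw [← hconv, expMoment, ← integral_indicator measurableSet_Ioo]
  have hae : ∀ᵐ s, s ∈ Ioo (0 : ℝ) 2 → (autoconv x) s = autoconvFun x s :=
    (ae_restrict_iff' measurableSet_Ioo).1 (memLp_autoconvFun x).coeFn_toLp
  refine integral_congr_ae ?_
  filter_upwards [hae] with s hs
  rw [convolution_def]
  by_cases h : s ∈ Ioo (0 : ℝ) 2
  · rw [indicator_of_mem h, hs h, autoconvFun_eq_convolution x h, ← integral_const_mul]
    congr 1
    funext t
    have : Complex.exp (z * s) = Complex.exp (z * t) * Complex.exp (z * (s - t : ℝ)) := by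
      rw [← Complex.exp_add]
      congr 1
      push_cast
      ring
    simp only [ContinuousLinearMap.mul_apply', hg, this]
    ring
  · rw [indicator_of_notMem h]
    refine (integral_eq_zero_of_ae (Eventually.of_forall fun t => ?_)).symm
    simp only [ContinuousLinearMap.mul_apply', Pi.zero_apply, hgi]
    by_cases h1 : t ∈ Ioo (0 : ℝ) 1
    · have h2 : s - t ∉ Ioo (0 : ℝ) 1 := fun h2 =>
        h ⟨by linarith [h1.1, h2.1], by linarith [h1.2, h2.2]⟩
      rw [indicator_of_notMem h2, mul_zero]
    · rw [indicator_of_notMem h1, zero_mul]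

theorem eq_or_eq_neg_of_expMoment_sq_eq {T : ℝ}
    {x y : Lp ℂ 2 (volume.restrict (Ioo (0 : ℝ) T))}
    (h : ∀ z, expMoment x z ^ 2 = expMoment y z ^ 2) : x = y ∨ x = -y := by
  have hsub := (differentiable_expMoment (x - y)).differentiableOn.analyticOnNhd isOpen_univ
  have hadd := (differentiable_expMoment (x + y)).differentiableOn.analyticOnNhd isOpen_univ
  refine (hsub.eq_zero_or_eq_zero_of_mul_eq_zero hadd (fun z _ => ?_) isPreconnected_univ).imp
    (fun h0 => sub_eq_zero.1 (eq_zero_of_expMoment_eq_zero fun z => h0 z (mem_univ z)))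
    fun h0 => eq_neg_of_add_eq_zero_left (eq_zero_of_expMoment_eq_zero fun z => h0 z (mem_univ z))
  rw [expMoment_sub, expMoment_add]
  linear_combination h z

theorem autoconv_eq_autoconv_iff {x y : L2Unit} :
    autoconv x = autoconv y ↔ x = y ∨ x = -y := by
  constructor
  · intro h
    refine eq_or_eq_neg_of_expMoment_sq_eq fun z => ?_
    rw [← expMoment_autoconv, h, expMoment_autoconv]
  · rintro (rfl | rfl)
    · rfl
    · refine sub_eq_zero.1 (eq_zero_of_expMoment_eq_zero fun z => ?_)
      rw [expMoment_sub, expMoment_autoconv, expMoment_autoconv, expMoment_eq_inner,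
        expMoment_eq_inner, inner_neg_right]
      ring

end ExpMoment

/-! ### Weak compactness along ultrafilters. -/

section WeakLimit

/-- Banach–Alaoglu, transported by the Riesz isometry. -/
theorem exists_ultrafilter_weak_limit {ι 𝕜 E : Type*} [RCLike 𝕜] [NormedAddCommGroup E]
    [InnerProductSpace 𝕜 E] [CompleteSpace E] (l : Ultrafilter ι) {u : ι → E} {R : ℝ}
    (hu : ∀ i, ‖u i‖ ≤ R) :
    ∃ x : E, ∀ v, Tendsto (fun i => inner 𝕜 v (u i)) l (𝓝 (inner 𝕜 v x)) := by
  let w : ι → WeakDual 𝕜 E := fun i => StrongDual.toWeakDual (InnerProductSpace.toDual 𝕜 E (u i))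
  have hK := WeakDual.isCompact_closedBall (𝕜 := 𝕜) (E := E) 0 R
  obtain ⟨a, -, ha⟩ := hK.ultrafilter_le_nhds (l.map w) (by
    rw [le_principal_iff, Ultrafilter.mem_coe, Ultrafilter.mem_map]
    refine Filter.univ_mem' fun i => ?_
    change InnerProductSpace.toDual 𝕜 E (u i) ∈ Metric.closedBall 0 R
    rw [mem_closedBall_zero_iff, LinearIsometryEquiv.norm_map]
    exact hu i)
  have hw : Tendsto w l (𝓝 a) := ha
  refine ⟨(InnerProductSpace.toDual 𝕜 E).symm (WeakDual.toStrongDual a), fun v => ?_⟩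
  have hv : Tendsto (fun i => w i v) l (𝓝 (a v)) :=
    ((WeakDual.eval_continuous v).tendsto a).comp hw
  have hs := (RCLike.continuous_conj (K := 𝕜)).tendsto (a v) |>.comp hv
  rw [← inner_conj_symm, InnerProductSpace.toDual_symm_apply]
  refine hs.congr fun i => ?_
  exact inner_conj_symm v (u i)

end WeakLimit

/-! ### Bounding the defect by the residual. -/

section Residual

/-- A sequence, bounded in norm, whose images under the autoconvolution converge strongly to
`autoconv y`, converges weakly to `y` or to `-y` along any ultrafilter. -/
theorem weak_limit_of_tendsto_autoconv {ι : Type*} (l : Ultrafilter ι) {u : ι → L2Unit} {R : ℝ}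
    (hu : ∀ i, ‖u i‖ ≤ R) {y : L2Unit}
    (h : Tendsto (fun i => autoconv (u i)) l (𝓝 (autoconv y))) :
    ∃ x : L2Unit, (x = y ∨ x = -y) ∧
      ∀ v, Tendsto (fun i => inner ℂ v (u i)) l (𝓝 (inner ℂ v x)) := by
  obtain ⟨x, hx⟩ := exists_ultrafilter_weak_limit (𝕜 := ℂ) l hu
  refine ⟨x, eq_or_eq_neg_of_expMoment_sq_eq fun z => ?_, hx⟩
  have h1 : Tendsto (fun i => expMoment (u i) z ^ 2) l (𝓝 (expMoment x z ^ 2)) := by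
    simp only [expMoment_eq_inner]
    exact (hx _).pow 2
  have h2 : Tendsto (fun i => expMoment (u i) z ^ 2) l (𝓝 (expMoment y z ^ 2)) := by
    simp only [← expMoment_autoconv, expMoment_eq_inner (T := 2)]
    exact tendsto_const_nhds.inner h
  exact tendsto_nhds_unique h1 h2

theorem twoPointError_le (y x : L2Unit) : twoPointError y x ≤ 2 * (‖x‖ ^ 2 + ‖y‖ ^ 2) := by
  have := parallelogram_law_with_norm ℂ x y
  refine (min_le_left _ _).trans ?_
  nlinarith [sq_nonneg ‖x + y‖]

/-- The defect `¼ E(x) - ‖x‖² + ‖y‖²` is bounded by `2 Re ⟨a, a - x⟩` for `a = y` and `a = -y`. -/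
theorem defect_le_inner {y a : L2Unit} (ha : a = y ∨ a = -y) (x : L2Unit) :
    1 / 4 * twoPointError y x - ‖x‖ ^ 2 + ‖y‖ ^ 2 ≤
      2 * (inner ℂ a a).re - 2 * (inner ℂ a x).re := by
  have hE : twoPointError y x ≤ ‖x - a‖ ^ 2 := by
    rcases ha with rfl | rfl
    · exact min_le_left _ _
    · rw [sub_neg_eq_add]
      exact min_le_right _ _
  have hn : ‖y‖ = ‖a‖ := by rcases ha with rfl | rfl <;> simp
  have h1 := @norm_sub_sq ℂ _ _ _ _ x a
  have h2 : RCLike.re (inner ℂ x a) = (inner ℂ a x).re := inner_re_symm _ _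
  have h3 : (inner ℂ a a).re = ‖a‖ ^ 2 := inner_self_eq_norm_sq (𝕜 := ℂ) a
  rw [h2] at h1
  rw [h3, hn]
  nlinarith [sq_nonneg ‖x - a‖]

theorem exists_residual_bound (y : L2Unit) {ε : ℝ} (hε : 0 < ε) :
    ∃ δ > 0, ∀ x : L2Unit, ‖autoconv x - autoconv y‖ < δ →
      1 / 4 * twoPointError y x - ‖x‖ ^ 2 + ‖y‖ ^ 2 ≤ ε := by
  by_contra! hcon
  choose u hu hval using fun n : ℕ => hcon (1 / ((n : ℝ) + 1)) (by positivity)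
  -- The defect is at most `3/2 ‖y‖² - 1/2 ‖x‖²`; being positive it gives `‖u n‖² < 3 ‖y‖²`.
  have hbd : ∀ n, ‖u n‖ ≤ 2 * ‖y‖ := fun n => by
    refine abs_le_of_sq_le_sq' ?_ (by positivity) |>.2
    have := twoPointError_le y (u n)
    nlinarith [hval n]
  let l : Ultrafilter ℕ := hyperfilter ℕ
  have hl : (l : Filter ℕ) ≤ atTop := Nat.hyperfilter_le_atTop
  have hF : Tendsto (fun n => autoconv (u n)) l (𝓝 (autoconv y)) := by
    rw [tendsto_iff_norm_sub_tendsto_zero]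
    exact (squeeze_zero (fun n => norm_nonneg _) (fun n => (hu n).le)
      tendsto_one_div_add_atTop_nhds_zero_nat).mono_left hl
  obtain ⟨a, ha, hlim⟩ := weak_limit_of_tendsto_autoconv l hbd hF
  have hre : Tendsto (fun n => 2 * (inner ℂ a a).re - 2 * (inner ℂ a (u n)).re) l
      (𝓝 (2 * (inner ℂ a a).re - 2 * (inner ℂ a a).re)) :=
    (((Complex.continuous_re.tendsto _).comp (hlim a)).const_mul 2).const_sub _
  rw [sub_self] at hre
  have := ge_of_tendsto hre
    (Eventually.of_forall fun n => (hval n).le.trans (defect_le_inner ha (u n)))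
  linarith

theorem exists_affine_bound (y : L2Unit) {ε : ℝ} (hε : 0 < ε) :
    ∃ K : ℝ≥0, ∀ x : L2Unit, 1 / 4 * twoPointError y x - ‖x‖ ^ 2 + ‖y‖ ^ 2 ≤
      ε + K * ‖autoconv x - autoconv y‖ := by
  obtain ⟨δ, hδ, h⟩ := exists_residual_bound y hε
  -- The slope makes the linear term reach the global defect bound `3/2 ‖y‖²` once the residual is
  -- at least `δ`.
  refine ⟨NNReal.mk (3 / 2 * ‖y‖ ^ 2 / δ) (by positivity), fun x => ?_⟩
  rw [NNReal.coe_mk]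
  rcases lt_or_ge ‖autoconv x - autoconv y‖ δ with hlt | hge
  · have : 0 ≤ 3 / 2 * ‖y‖ ^ 2 / δ * ‖autoconv x - autoconv y‖ := by positivity
    linarith [h x hlt]
  · have h1 : 3 / 2 * ‖y‖ ^ 2 / δ * δ ≤ 3 / 2 * ‖y‖ ^ 2 / δ * ‖autoconv x - autoconv y‖ :=
      mul_le_mul_of_nonneg_left hge (by positivity)
    rw [div_mul_cancel₀ _ hδ.ne'] at h1
    nlinarith [twoPointError_le y x, sq_nonneg ‖x‖]

end Residual

/-! ### Concave majorant from affine bounds. -/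

section IndexFunction

/-- A concave index function lying above every real number that is dominated by all the affine
functions `t ↦ 1/(n+1) + K n * t`. -/
theorem exists_concave_indexFunction (K : ℕ → ℝ≥0) :
    ∃ φ : ℝ≥0 → ℝ≥0, IsIndexFunction φ ∧ ConcaveOn ℝ≥0 univ φ ∧
      ∀ (t : ℝ≥0) (c : ℝ), (∀ n : ℕ, c ≤ 1 / ((n : ℝ) + 1) + K n * t) → c ≤ φ t := by
  let ψ : ℝ≥0 → ℝ≥0 := fun t => ⨅ n : ℕ, (1 / ((n : ℝ≥0) + 1) + K n * t)
  have hψle : ∀ (t : ℝ≥0) (n : ℕ), ψ t ≤ 1 / ((n : ℝ≥0) + 1) + K n * t := fun t n => ciInf_le' _ n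
  have hmono : Monotone ψ := fun s t hst =>
    le_ciInf fun n => (hψle s n).trans (by gcongr)
  have hlim : Tendsto (fun n : ℕ => 1 / ((n : ℝ≥0) + 1)) atTop (𝓝 0) :=
    tendsto_one_div_add_atTop_nhds_zero_nat
  have hzero : ψ 0 = 0 := by
    refine le_antisymm (ge_of_tendsto' hlim fun n => ?_) zero_le
    simpa using hψle 0 n
  -- For two competing lines, the one with the smaller slope serves at `s + t`. Subadditivity and
  -- monotonicity then reduce continuity to continuity at 0.
  have hsub : ∀ s t, ψ (s + t) ≤ ψ s + ψ t := fun s t => by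
    refine NNReal.le_iInf_add_iInf fun m n => ?_
    rcases le_total (K m) (K n) with h | h
    · calc ψ (s + t) ≤ 1 / ((m : ℝ≥0) + 1) + K m * (s + t) := hψle _ m
        _ = 1 / ((m : ℝ≥0) + 1) + K m * s + K m * t := by ring
        _ ≤ 1 / ((m : ℝ≥0) + 1) + K m * s + (1 / ((n : ℝ≥0) + 1) + K n * t) := by
          gcongr
          exact (mul_le_mul_left h t).trans le_add_self
    · calc ψ (s + t) ≤ 1 / ((n : ℝ≥0) + 1) + K n * (s + t) := hψle _ n
        _ = K n * s + (1 / ((n : ℝ≥0) + 1) + K n * t) := by ring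
        _ ≤ 1 / ((m : ℝ≥0) + 1) + K m * s + (1 / ((n : ℝ≥0) + 1) + K n * t) := by
          gcongr
          exact (mul_le_mul_left h s).trans le_add_self
  have hcont0 : Tendsto ψ (𝓝 0) (𝓝 0) := by
    rw [tendsto_order]
    refine ⟨fun a ha => absurd ha not_lt_zero, fun a ha => ?_⟩
    obtain ⟨n, hn⟩ := ((tendsto_order.1 hlim).2 a ha).exists
    have hc : Tendsto (fun t : ℝ≥0 => 1 / ((n : ℝ≥0) + 1) + K n * t) (𝓝 0)
        (𝓝 (1 / ((n : ℝ≥0) + 1) + K n * 0)) :=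
      Continuous.tendsto (by fun_prop) 0
    rw [mul_zero, add_zero] at hc
    filter_upwards [(tendsto_order.1 hc).2 a hn] with t ht
    exact (hψle t n).trans_lt ht
  have hcont : Continuous ψ := by
    rw [continuous_iff_continuousAt]
    intro t
    rw [ContinuousAt, tendsto_iff_dist_tendsto_zero]
    have hle : ∀ s, dist (ψ s) (ψ t) ≤ ψ (nndist s t) := by
      have aux : ∀ a b : ℝ≥0, a ≤ b → dist (ψ a) (ψ b) ≤ ψ (nndist a b) := fun a b hab => by
        have h1 : (ψ a : ℝ) ≤ ψ b := NNReal.coe_le_coe.2 (hmono hab)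
        have h2 : nndist a b = b - a := by
          rw [NNReal.nndist_eq, tsub_eq_zero_of_le hab, max_eq_right zero_le]
        have h3 : (ψ b : ℝ) ≤ ψ a + ψ (nndist a b) := by
          rw [h2]
          have := hsub a (b - a)
          rw [add_tsub_cancel_of_le hab] at this
          exact_mod_cast this
        rw [NNReal.dist_eq, abs_of_nonpos (by linarith)]
        linarith
      intro s
      rcases le_total s t with h | h
      · exact aux s t h
      · rw [dist_comm, nndist_comm]
        exact aux t s h
    refine squeeze_zero (fun s => dist_nonneg) hle ?_
    have hn : Tendsto (fun s => nndist s t) (𝓝 t) (𝓝 0) := by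
      have := (continuous_id.nndist continuous_const : Continuous fun s : ℝ≥0 => nndist s t).tendsto t
      rwa [id, nndist_self] at this
    exact NNReal.tendsto_coe.2 (hcont0.comp hn)
  -- The summand `t` supplies strict growth: `ψ` vanishes identically when `K = 0`.
  have hstrict : StrictMono fun t => t + ψ t := strictMono_id.add_monotone hmono
  refine ⟨fun t => t + ψ t, ⟨continuous_id.add hcont, hstrict.monotone,
    ⟨1, one_pos, hstrict.strictMonoOn _⟩, by simp [hzero]⟩, ?_, fun t c hc => ?_⟩
  · refine (concaveOn_id convex_univ).add ⟨convex_univ, fun s _ t _ a b _ _ hab => ?_⟩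
    refine le_ciInf fun n => ?_
    calc a • ψ s + b • ψ t
        ≤ a * (1 / ((n : ℝ≥0) + 1) + K n * s) + b * (1 / ((n : ℝ≥0) + 1) + K n * t) := by
          gcongr
          · exact mul_le_mul_right (hψle s n) a
          · exact mul_le_mul_right (hψle t n) b
      _ = (a + b) * (1 / ((n : ℝ≥0) + 1)) + K n * (a * s + b * t) := by ring
      _ = 1 / ((n : ℝ≥0) + 1) + K n * (a • s + b • t) := by
          rw [hab, one_mul, smul_eq_mul, smul_eq_mul]
  · rcases le_or_gt c 0 with h | h
    · exact h.trans (NNReal.coe_nonneg _)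
    · lift c to ℝ≥0 using h.le
      refine NNReal.coe_le_coe.2 (le_trans ?_ le_add_self)
      exact le_ciInf fun n => by exact_mod_cast hc n

end IndexFunction

theorem mainTheorem5 (ydag : L2Two) (xdag : L2Unit) (hx : autoconv xdag = ydag) :
    ∃ β ∈ Ioo (0 : ℝ) 1, ∃ φ : ℝ≥0 → ℝ≥0, IsIndexFunction φ ∧ ConcaveOn ℝ≥0 univ φ ∧
      VariationalSourceCondition autoconv ydag (fun x : L2Unit => ‖x‖ ^ 2) (twoPointError xdag)
        β φ univ := by
  subst hx
  choose K hK using fun n : ℕ =>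
    exists_affine_bound xdag (ε := 1 / ((n : ℝ) + 1)) (by positivity)
  obtain ⟨φ, hφ, hconc, hle⟩ := exists_concave_indexFunction K
  refine ⟨1 / 4, by norm_num, φ, hφ, hconc, ‖xdag‖ ^ 2, ⟨⟨xdag, rfl, rfl⟩, ?_⟩, fun x _ => ?_⟩
  · rintro _ ⟨x, hx, rfl⟩
    rcases autoconv_eq_autoconv_iff.1 hx with rfl | rfl <;> simp
  · have := hle ‖autoconv x - autoconv xdag‖₊ _ fun n => hK n x
    change 1 / 4 * twoPointError xdag x ≤ ‖x‖ ^ 2 - ‖xdag‖ ^ 2 + _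
    linarith
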